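/- Let $N\ge 1$ and $Q\ge 0$ be integers and equip $\mathbb{R}^N$ with its Euclidean structure. Write $J=\|\cdot\|_\infty$ for the $\ell^\infty$ norm on $\mathbb{R}^N$, $\partial J(x)=\{u : J(y)\ge J(x)+\langle u,y-x\rangle \text{ for all } y\in\mathbb{R}^N\}$ for its subdifferential at $x$, and $P_V$ for the orthogonal projector onto a subspace $V$. For $x\in\mathbb{R}^N$ let - $I=\{i : |x_i|=\|x\|_\infty\}$ be the saturation support of $x$ and $|I|$ its cardinality, - $e_x$ be the element of minimal Euclidean norm of the affine hull $\operatorname{Aff}\partial J(x)$, - $S_x=\operatorname{Aff}\partial J(x)-e_x$ be the direction of this affine hull, and $T_x=S_x^\perp$ the model tangent subspace. For a real $Q\times N$ matrix $\Phi$ and a subspace $V$ put $\Phi_V=\Phi P_V$, and let $A^+$ denote the Moore–Penrose pseudo-inverse of $A$ and $A^*$ its adjoint. If $\operatorname{Ker}(\Phi)\cap T_x=\{0\}$, the irrepresentability criterion at $x$ is $$\mathrm{IC}(x)=\gamma\big(\Phi_{S_x}^*(\Phi_{T_x}^{+})^{*}e_x-P_{S_x}f_x\big)\in[0,+\infty],\qquad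 f_x=e_x,$$ where $\gamma(v)=\inf\{\lambda>0 : v\in\lambda(\partial J(x)-f_x)\}$ (with $\inf\emptyset=+\infty$) is the gauge of $\partial J(x)-f_x$. **Theorem.** Let $x\in\mathbb{R}^N$ be arbitrary, with saturation support $I$, and let $\beta>1$. Let $\Phi$ be a random $Q\times N$ matrix whose entries are independent standard normal variables, and suppose that $$Q\ \ge\ N-|I|+2\beta|I|\log(|I|/2).$$ Then, with probability at least $1-2(|I|/2)^{-f(\beta,|I|)}$, one has $\operatorname{Ker}(\Phi)\cap T_x=\{0\}$ (so that $\mathrm{IC}(x)$ is defined) and $\mathrm{IC}(x)<1$, where $$f(\beta,|I|)=\left(\sqrt{\frac{\beta}{2|I|}+\beta-1}-\sqrt{\frac{\beta}{2|I|}}\right)^2 .$$ -/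

import Mathlib

open MeasureTheory ProbabilityTheory
open scoped ENNReal InnerProductSpace

noncomputable section

namespace PartlySmooth

section General

variable {E F : Type*} [NormedAddCommGroup E] [InnerProductSpace ℝ E] [FiniteDimensional ℝ E]
  [NormedAddCommGroup F] [InnerProductSpace ℝ F] [FiniteDimensional ℝ F]

/-- The subdifferential of a finite-valued function `J` at `x`. -/
def subdifferential (J : E → ℝ) (x : E) : Set E :=
  {u | ∀ y, J x + ⟪u, y - x⟫_ℝ ≤ J y}

/-- The affine hull of the subdifferential of `J` at `x`. -/
def affineHull (J : E → ℝ) (x : E) : AffineSubspace ℝ E :=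
  affineSpan ℝ (subdifferential J x)

open Classical in
/-- The model vector `e_x`: the orthogonal projection of `0` onto the affine hull of the
subdifferential, that is, the element of least norm of this hull. (The subdifferential of a
finite-valued convex function is never empty; `0` is a dummy value in the other case.) -/
def modelVector (J : E → ℝ) (x : E) : E :=
  if _h : Nonempty (affineHull J x) then
    (EuclideanGeometry.orthogonalProjection (affineHull J x) (0 : E) : E)
  else 0

/-- The subspace `S_x`, the direction of the affine hull of the subdifferential. -/
def subspaceS (J : E → ℝ) (x : E) : Submodule ℝ E := (affineHull J x).direction

/-- The model tangent subspace `T_x`, the orthogonal complement of `S_x`. -/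
def modelSubspace (J : E → ℝ) (x : E) : Submodule ℝ E := (subspaceS J x)ᗮ

/-- The gauge of a set `C`: the infimum of all `r > 0` with `v ∈ r C`, which is `∞` when there is
no such `r`. -/
def extGauge (C : Set E) (v : E) : ℝ≥0∞ :=
  ⨅ (r : ℝ) (_ : 0 < r ∧ ∃ c ∈ C, v = r • c), ENNReal.ofReal r

/-- The subdifferential gauge of `J` at `x` for the reference point `f`: the gauge of the
translated set `∂J(x) - f`. -/
def subdiffGauge (J : E → ℝ) (x f : E) : E → ℝ≥0∞ :=
  extGauge ((fun u => u - f) '' subdifferential J x)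

/-- The map `Φ_V = Φ ∘ P_V`, where `P_V` is the orthogonal projector onto `V`. -/
def restrictTo (Φ : E →ₗ[ℝ] F) (V : Submodule ℝ E) : E →ₗ[ℝ] F :=
  Φ ∘ₗ (V.starProjection : E →ₗ[ℝ] E)

/-- The Moore-Penrose pseudo-inverse: project orthogonally onto the range of `A`, then invert the
bijection from the orthogonal complement of the kernel of `A` onto the range of `A`. -/
def pinv (A : E →ₗ[ℝ] F) : F →ₗ[ℝ] E :=
  (LinearMap.ker A)ᗮ.subtype ∘ₗ
    ((A.kerComplementEquivRange
      (Submodule.isCompl_orthogonal (K := LinearMap.ker A)).symm).symm :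
        LinearMap.range A →ₗ[ℝ] (LinearMap.ker A)ᗮ) ∘ₗ
    ((LinearMap.range A).orthogonalProjectionOnto : F →ₗ[ℝ] LinearMap.range A)

theorem comp_pinv (A : E →ₗ[ℝ] F) :
    A ∘ₗ pinv A = ((LinearMap.range A).starProjection : F →ₗ[ℝ] F) := by
  ext y
  have h := congrArg Subtype.val
    ((A.kerComplementEquivRange
      (Submodule.isCompl_orthogonal
        (K := LinearMap.ker A)).symm).apply_symm_apply
      ((LinearMap.range A).orthogonalProjectionOnto y))
  exact h

theorem pinv_comp (A : E →ₗ[ℝ] F) :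
    pinv A ∘ₗ A = ((LinearMap.ker A)ᗮ.starProjection : E →ₗ[ℝ] E) := by
  ext v
  set e := A.kerComplementEquivRange
    (Submodule.isCompl_orthogonal (K := LinearMap.ker A)).symm with he
  have h1 : (LinearMap.range A).orthogonalProjectionOnto (A v)
      = e ((LinearMap.ker A)ᗮ.orthogonalProjectionOnto v) := by
    apply Subtype.ext
    have h2 : v - ((LinearMap.ker A)ᗮ.orthogonalProjectionOnto v : E) ∈ LinearMap.ker A := by
      have := Submodule.sub_starProjection_mem_orthogonal (K := (LinearMap.ker A)ᗮ) v
      rwa [Submodule.orthogonal_orthogonal] at this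
    have h3 : A v = A ((LinearMap.ker A)ᗮ.orthogonalProjectionOnto v : E) := by
      rw [LinearMap.mem_ker, map_sub, sub_eq_zero] at h2
      exact h2
    have h4 := Submodule.starProjection_eq_self_iff.mpr (LinearMap.mem_range_self A v)
    calc _ = A v := h4
      _ = _ := h3
  change ((e.symm ((LinearMap.range A).orthogonalProjectionOnto (A v)) : _) : E) = _
  rw [h1, LinearEquiv.symm_apply_apply]
  rfl

/-- The restricted injectivity condition `Ker Φ ∩ V = {0}`. -/
def RestrictedInjective (Φ : E →ₗ[ℝ] F) (V : Submodule ℝ E) : Prop :=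
  LinearMap.ker Φ ⊓ V = ⊥

/-- The irrepresentability criterion of `J` at `x` for the measurement operator `Φ` and the
reference point `f`: the subdifferential gauge of `Φ_S^* (Φ_T^+)^* e_x - P_S f`. -/
def irrepresentability (J : E → ℝ) (Φ : E →ₗ[ℝ] F) (x f : E) : ℝ≥0∞ :=
  subdiffGauge J x f
    (LinearMap.adjoint (restrictTo Φ (subspaceS J x))
        (LinearMap.adjoint (pinv (restrictTo Φ (modelSubspace J x))) (modelVector J x))
      - (subspaceS J x).starProjection f)

end General

/-- The `ℓ∞` norm on `ℝ^N`, whose elements carry the Euclidean structure. -/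
def linfNorm {N : ℕ} (x : EuclideanSpace ℝ (Fin N)) : ℝ := ‖(WithLp.ofLp x : Fin N → ℝ)‖

/-- The saturation support of `x`: the indices of the entries of largest modulus. -/
def saturationSupport {N : ℕ} (x : EuclideanSpace ℝ (Fin N)) : Finset (Fin N) :=
  Finset.univ.filter fun i => |x i| = linfNorm x

/-- The irrepresentability criterion `IC(x)` of the `ℓ∞` norm for the matrix `Φ`, where the
reference point in the relative interior of the subdifferential is `f_x = e_x`. -/
def linfIC {Q N : ℕ} (Φ : Matrix (Fin Q) (Fin N) ℝ) (x : EuclideanSpace ℝ (Fin N)) : ℝ≥0∞ :=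
  irrepresentability linfNorm (Matrix.toEuclideanLin Φ) x (modelVector linfNorm x)

/-- A random `Q × N` matrix from the standard Gaussian ensemble: the entries are independent
standard normal variables. -/
structure IsStandardGaussianEnsemble {Ω : Type*} [MeasurableSpace Ω] {Q N : ℕ}
    (Φ : Ω → Matrix (Fin Q) (Fin N) ℝ) (P : Measure Ω) : Prop where
  hasLaw : ∀ i j, HasLaw (fun ω => Φ ω i j) (gaussianReal 0 1) P
  indep : iIndepFun (fun (p : Fin Q × Fin N) (ω : Ω) => Φ ω p.1 p.2) P

/-- The exponent `f(β, k)` of the failure probability. -/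
def exponent (β k : ℝ) : ℝ :=
  (Real.sqrt (β / (2 * k) + β - 1) - Real.sqrt (β / (2 * k))) ^ 2

end PartlySmooth

end

namespace PartlySmooth

noncomputable section

/-! ### Linear algebra of the criterion for a general function `J`. -/

section Criterion

variable {E F : Type*} [NormedAddCommGroup E] [InnerProductSpace ℝ E] [FiniteDimensional ℝ E]
  [NormedAddCommGroup F] [InnerProductSpace ℝ F] [FiniteDimensional ℝ F]

/-! Deterministic half. For `x ≠ 0` put `s = saturatedSign x`, `k = |I|`, and let `a_j` be the
columns of `Φ`. The subdifferential is the simplex with vertices `s_i ε_i`, `i ∈ I` (`ε_i` the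
standard basis), so `e_x = s / k` is its barycentre, and `T_x` is spanned by `s` and the `ε_j` with
`j ∉ I`. Let `W` be the span of the columns off `I`, `P` the projector onto its orthogonal
complement and `G = ∑_{j ∈ I} s_j a_j`. The vector `w = (Φ_T^+)^* e_x` is orthogonal to `W` and lies
in the range of `Φ_T`, hence is a multiple of `P G`, positive since `⟪w, G⟫ = 1`. The argument of
the gauge is `Φ^* w - e_x`, so the criterion is below one as soon as `Φ^* w` has positive
barycentric coordinates, that is, `⟪P (s_i a_i), G⟫ > 0` for all `i ∈ I`. This is
`irrepresentability_linfNorm_lt_one`.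

Probabilistic half. For fixed `i`, split `G = s_i a_i + (rest)`. Given `a_i` and `W`, the rest is a
centred Gaussian with covariance `k - 1` times the identity, so Chernoff's method with parameter `t
= 1 / (k - 1)` bounds the probability of `⟪P (s_i a_i), G⟫ ≤ 0` by the mean of `exp (-(t / 2) ‖P
a_i‖²)`. Given `W`, `‖P a_i‖²` is chi-squared with at least `d = Q - (N - k)` degrees of freedom, so
this mean is at most `(1 + t)^(-d/2) = (1 - 1/k)^(d/2) ≤ exp (-d / (2k))`
(`measure_residualInner_nonpos_le`). The hypothesis on `Q` makes it at most `(k/2)^(-β)`, and a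
union bound over `I` gives `2 (k/2)^(1-β)`. Since `exponent β k ≤ β - 1`, this is stronger than
required. -/

theorem mem_modelSubspace_iff {J : E → ℝ} {x τ : E} :
    τ ∈ modelSubspace J x ↔
      ∀ u ∈ subdifferential J x, ∀ v ∈ subdifferential J x, ⟪u - v, τ⟫_ℝ = 0 := by
  rw [modelSubspace, subspaceS, affineHull, direction_affineSpan, vectorSpan_def]
  constructor
  · intro h u hu v hv
    exact (Submodule.mem_orthogonal _ _).1 h _ (Submodule.subset_span (Set.vsub_mem_vsub hu hv))
  · intro h
    have hle : Submodule.span ℝ (subdifferential J x -ᵥ subdifferential J x) ≤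
        (Submodule.span ℝ {τ})ᗮ := by
      rw [Submodule.span_le]
      rintro _ ⟨u, hu, v, hv, rfl⟩
      rw [SetLike.mem_coe, Submodule.mem_orthogonal_singleton_iff_inner_left]
      exact h u hu v hv
    rw [Submodule.mem_orthogonal]
    intro u hu
    exact Submodule.mem_orthogonal_singleton_iff_inner_left.1 (hle hu)

/-- A point of the hull orthogonal to its direction is the projection of the origin. -/
theorem modelVector_eq {J : E → ℝ} {x e : E} (he : e ∈ affineHull J x)
    (h : e ∈ modelSubspace J x) : modelVector J x = e := by
  have hne : Nonempty (affineHull J x) := ⟨⟨e, he⟩⟩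
  rw [modelVector, dif_pos hne, EuclideanGeometry.coe_orthogonalProjection_eq_iff_mem]
  refine ⟨he, ?_⟩
  rw [vsub_eq_sub, zero_sub]
  exact Submodule.neg_mem _ h

theorem ker_restrictTo {L : E →ₗ[ℝ] F} {V : Submodule ℝ E} (h : RestrictedInjective L V) :
    LinearMap.ker (restrictTo L V) = Vᗮ := by
  ext v
  rw [LinearMap.mem_ker]
  change L (V.starProjection v) = 0 ↔ _
  rw [← Submodule.starProjection_apply_eq_zero_iff]
  constructor
  · intro hv
    have : V.starProjection v ∈ LinearMap.ker L ⊓ V :=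
      ⟨LinearMap.mem_ker.2 hv, Submodule.starProjection_apply_mem _ _⟩
    rwa [h, Submodule.mem_bot] at this
  · intro hv
    rw [hv, map_zero]

theorem adjoint_restrictTo_apply (L : E →ₗ[ℝ] F) (V : Submodule ℝ E) (w : F) :
    LinearMap.adjoint (restrictTo L V) w = V.starProjection (LinearMap.adjoint L w) := by
  refine ext_inner_right ℝ fun v => ?_
  rw [LinearMap.adjoint_inner_left, Submodule.inner_starProjection_left_eq_right,
    LinearMap.adjoint_inner_left]
  rfl

/-- Injectivity on `V` makes `Vᗮ` the kernel of `L ∘ P_V`, so its pseudo-inverse is a left inverse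
up to the self-adjoint projector `P_V`; the claim is the adjoint of this identity. -/
theorem starProjection_adjoint_adjoint_pinv {L : E →ₗ[ℝ] F} {V : Submodule ℝ E}
    (h : RestrictedInjective L V) {e : E} (he : e ∈ V) :
    V.starProjection (LinearMap.adjoint L (LinearMap.adjoint (pinv (restrictTo L V)) e)) = e := by
  rw [← adjoint_restrictTo_apply]
  refine ext_inner_right ℝ fun v => ?_
  rw [LinearMap.adjoint_inner_left, LinearMap.adjoint_inner_left]
  have h1 : pinv (restrictTo L V) (restrictTo L V v) = Vᗮᗮ.starProjection v := by
    have := congrArg (fun f : E →ₗ[ℝ] E => f v) (pinv_comp (restrictTo L V))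
    simp only [ker_restrictTo h] at this
    exact this
  rw [h1, ← Submodule.inner_starProjection_left_eq_right]
  congr 1
  rw [Submodule.starProjection_eq_self_iff, Submodule.orthogonal_orthogonal]
  exact he

theorem adjoint_pinv_mem_range (A : E →ₗ[ℝ] F) (e : E) :
    LinearMap.adjoint (pinv A) e ∈ LinearMap.range A := by
  rw [← Submodule.orthogonal_orthogonal (LinearMap.range A), Submodule.mem_orthogonal]
  intro z hz
  rw [LinearMap.adjoint_inner_right]
  have : pinv A z = 0 := by
    have h0 : (LinearMap.range A).orthogonalProjectionOnto z = 0 :=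
      Submodule.orthogonalProjectionOnto_eq_zero_iff.2 hz
    simp only [pinv, LinearMap.comp_apply, ContinuousLinearMap.coe_coe, h0,
      map_zero]
  rw [this, inner_zero_left]

/-- The component of `L^* w` along `T` is exactly `e`, and `P_S e = 0`; both projectors therefore
disappear from the criterion. -/
theorem irrepresentability_argument {J : E → ℝ} {L : E →ₗ[ℝ] F} {x e : E}
    (h : RestrictedInjective L (modelSubspace J x)) (he : e ∈ modelSubspace J x) (w : F)
    (hw : w = LinearMap.adjoint (pinv (restrictTo L (modelSubspace J x))) e) :
    LinearMap.adjoint (restrictTo L (subspaceS J x)) w - (subspaceS J x).starProjection e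
      = LinearMap.adjoint L w - e := by
  have h1 : (subspaceS J x).starProjection e = 0 :=
    (Submodule.starProjection_apply_eq_zero_iff _).2 he
  have h2 := starProjection_adjoint_adjoint_pinv h he
  rw [← hw] at h2
  have h3 : (subspaceS J x).starProjection (LinearMap.adjoint L w)
      + (modelSubspace J x).starProjection (LinearMap.adjoint L w) = LinearMap.adjoint L w :=
    Submodule.starProjection_add_starProjection_orthogonal (K := subspaceS J x) _
  rw [adjoint_restrictTo_apply, h1, sub_zero, eq_sub_iff_add_eq]
  rwa [h2] at h3

theorem extGauge_lt_one {C : Set E} {v c : E} {r : ℝ} (hr : 0 < r) (hr1 : r < 1) (hc : c ∈ C)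
    (hv : v = r • c) : extGauge C v < 1 := by
  refine lt_of_le_of_lt (iInf₂_le r ⟨hr, c, hc, hv⟩) ?_
  rw [← ENNReal.ofReal_one]
  exact (ENNReal.ofReal_lt_ofReal_iff one_pos).2 hr1

end Criterion

/-! ### The subdifferential of the max norm and the deterministic sufficient condition. -/

section LinfNorm

variable {N : ℕ}

theorem abs_le_linfNorm (x : EuclideanSpace ℝ (Fin N)) (i : Fin N) : |x i| ≤ linfNorm x :=
  norm_le_pi_norm (WithLp.ofLp x) i

theorem linfNorm_nonneg (x : EuclideanSpace ℝ (Fin N)) : 0 ≤ linfNorm x := norm_nonneg _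

theorem linfNorm_le {x : EuclideanSpace ℝ (Fin N)} {c : ℝ} (hc : 0 ≤ c) (h : ∀ i, |x i| ≤ c) :
    linfNorm x ≤ c :=
  (pi_norm_le_iff_of_nonneg hc).2 h

theorem linfNorm_pos {x : EuclideanSpace ℝ (Fin N)} (hx : x ≠ 0) : 0 < linfNorm x := by
  refine norm_pos_iff.2 fun h => hx ?_
  ext i
  exact congrFun h i

theorem linfNorm_zero : linfNorm (0 : EuclideanSpace ℝ (Fin N)) = 0 := norm_zero

theorem linfNorm_smul (c : ℝ) (x : EuclideanSpace ℝ (Fin N)) :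
    linfNorm (c • x) = |c| * linfNorm x := norm_smul _ _

theorem mem_saturationSupport {x : EuclideanSpace ℝ (Fin N)} {i : Fin N} :
    i ∈ saturationSupport x ↔ |x i| = linfNorm x := by
  simp [saturationSupport]

theorem saturationSupport_nonempty (hN : 0 < N) (x : EuclideanSpace ℝ (Fin N)) :
    (saturationSupport x).Nonempty := by
  have : Nonempty (Fin N) := ⟨⟨0, hN⟩⟩
  obtain ⟨i, hi⟩ := Finite.exists_max fun i => |x i|
  exact ⟨i, mem_saturationSupport.2 (le_antisymm (abs_le_linfNorm x i)
    (linfNorm_le (abs_nonneg _) hi))⟩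

/-- The sign pattern of `x` on its saturation support, extended by zero. -/
def saturatedSign (x : EuclideanSpace ℝ (Fin N)) : EuclideanSpace ℝ (Fin N) :=
  WithLp.toLp 2 fun i => if i ∈ saturationSupport x then x i / linfNorm x else 0

theorem saturatedSign_of_mem {x : EuclideanSpace ℝ (Fin N)} {i : Fin N}
    (hi : i ∈ saturationSupport x) : saturatedSign x i = x i / linfNorm x := by
  simp [saturatedSign, hi]

theorem saturatedSign_of_notMem {x : EuclideanSpace ℝ (Fin N)} {i : Fin N}
    (hi : i ∉ saturationSupport x) : saturatedSign x i = 0 := by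
  simp [saturatedSign, hi]

theorem saturatedSign_mul_self {x : EuclideanSpace ℝ (Fin N)} (hx : x ≠ 0) {i : Fin N}
    (hi : i ∈ saturationSupport x) : saturatedSign x i * saturatedSign x i = 1 := by
  have hm := (linfNorm_pos hx).ne'
  rw [saturatedSign_of_mem hi, div_mul_div_comm, ← abs_mul_abs_self (x i),
    mem_saturationSupport.1 hi]
  field_simp

theorem abs_saturatedSign_le_one {x : EuclideanSpace ℝ (Fin N)} (hx : x ≠ 0) (i : Fin N) :
    |saturatedSign x i| ≤ 1 := by
  by_cases hi : i ∈ saturationSupport x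
  · rw [abs_le_one_iff_mul_self_le_one, saturatedSign_mul_self hx hi]
  · simp [saturatedSign_of_notMem hi]

theorem inner_eq_sum (u v : EuclideanSpace ℝ (Fin N)) : ⟪u, v⟫_ℝ = ∑ i, u i * v i := by
  simp [PiLp.inner_apply, mul_comm]

theorem inner_self_eq_linfNorm_mul {x u : EuclideanSpace ℝ (Fin N)} (hx : x ≠ 0)
    (hu : ∀ i ∉ saturationSupport x, u i = 0) :
    ⟪u, x⟫_ℝ = linfNorm x * ⟪saturatedSign x, u⟫_ℝ := by
  rw [inner_eq_sum, inner_eq_sum, Finset.mul_sum]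
  refine Finset.sum_congr rfl fun i _ => ?_
  by_cases hi : i ∈ saturationSupport x
  · have hm := (linfNorm_pos hx).ne'
    rw [saturatedSign_of_mem hi]
    field_simp
  · simp [hu i hi]

/-- The products `s_i u_i` are convex weights, so `⟪u, y⟫` is an average of the `s_i y_i`, each at
most the norm of `y`, with equality when `y = x`. -/
theorem mem_subdifferential_of_nonneg {x u : EuclideanSpace ℝ (Fin N)} (hx : x ≠ 0)
    (hu : ∀ i ∉ saturationSupport x, u i = 0)
    (hpos : ∀ i ∈ saturationSupport x, 0 ≤ saturatedSign x i * u i)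
    (hsum : ⟪saturatedSign x, u⟫_ℝ = 1) : u ∈ subdifferential linfNorm x := by
  intro y
  have hle : ⟪u, y⟫_ℝ ≤ linfNorm y := by
    calc ⟪u, y⟫_ℝ = ∑ i, u i * y i := inner_eq_sum _ _
      _ ≤ ∑ i, (saturatedSign x i * u i) * linfNorm y := by
        refine Finset.sum_le_sum fun i _ => ?_
        by_cases hi : i ∈ saturationSupport x
        · have h1 : u i * y i = (saturatedSign x i * u i) * (saturatedSign x i * y i) := by
            linear_combination (-(u i * y i)) * saturatedSign_mul_self hx hi
          rw [h1]
          refine mul_le_mul_of_nonneg_left ?_ (hpos i hi)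
          refine (le_abs_self _).trans ?_
          rw [abs_mul]
          exact (mul_le_of_le_one_left (abs_nonneg _) (abs_saturatedSign_le_one hx i)).trans
            (abs_le_linfNorm y i)
        · simp [hu i hi]
      _ = linfNorm y := by rw [← Finset.sum_mul, ← inner_eq_sum, hsum, one_mul]
  rw [inner_sub_right, inner_self_eq_linfNorm_mul hx hu, hsum]
  linarith

theorem eq_zero_of_mem_subdifferential {x u : EuclideanSpace ℝ (Fin N)}
    (hu : u ∈ subdifferential linfNorm x) {j : Fin N} (hj : j ∉ saturationSupport x) :
    u j = 0 := by
  have hlt : |x j| < linfNorm x :=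
    lt_of_le_of_ne (abs_le_linfNorm x j) fun h => hj (mem_saturationSupport.2 h)
  -- An unsaturated entry can move by the gap in either direction without raising the norm.
  have key : ∀ t : ℝ, |t| ≤ linfNorm x - |x j| → t * u j ≤ 0 := by
    intro t ht
    have h1 := hu (x + EuclideanSpace.single j t)
    have h2 : linfNorm (x + EuclideanSpace.single j t) ≤ linfNorm x := by
      refine linfNorm_le (linfNorm_nonneg x) fun i => ?_
      by_cases hij : i = j
      · subst hij
        have := abs_add_le (x i) t
        simp only [PiLp.add_apply, PiLp.single_apply, if_true]
        linarith
      · simpa [hij] using abs_le_linfNorm x i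
    rw [add_sub_cancel_left, EuclideanSpace.inner_single_right] at h1
    simp only [conj_trivial] at h1
    linarith
  have hδ : 0 < linfNorm x - |x j| := by linarith
  have h1 := key (linfNorm x - |x j|) (abs_of_pos hδ).le
  have h2 := key (-(linfNorm x - |x j|)) (by rw [abs_neg, abs_of_pos hδ])
  have : (linfNorm x - |x j|) * u j = 0 := by linarith
  exact (mul_eq_zero.1 this).resolve_left hδ.ne'

/-- Homogeneity: testing the subgradient inequality at `0` and at `2 x` forces `⟪u, x⟫ = linfNorm
x`. -/
theorem inner_saturatedSign_of_mem_subdifferential {x u : EuclideanSpace ℝ (Fin N)} (hx : x ≠ 0)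
    (hu : u ∈ subdifferential linfNorm x) : ⟪saturatedSign x, u⟫_ℝ = 1 := by
  have h1 := hu 0
  have h2 := hu ((2 : ℝ) • x)
  rw [linfNorm_zero, zero_sub, inner_neg_right] at h1
  rw [linfNorm_smul, two_smul, add_sub_cancel_right, abs_two] at h2
  have h3 := inner_self_eq_linfNorm_mul hx
    fun i hi => eq_zero_of_mem_subdifferential hu hi
  have h4 : linfNorm x * (⟪saturatedSign x, u⟫_ℝ - 1) = 0 := by linarith
  have := (mul_eq_zero.1 h4).resolve_left (linfNorm_pos hx).ne'
  linarith

theorem single_saturatedSign_mem_subdifferential {x : EuclideanSpace ℝ (Fin N)} (hx : x ≠ 0)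
    {i : Fin N} (hi : i ∈ saturationSupport x) :
    EuclideanSpace.single i (saturatedSign x i) ∈ subdifferential linfNorm x := by
  refine mem_subdifferential_of_nonneg hx (fun j hj => ?_) (fun j _ => ?_) ?_
  · have : j ≠ i := fun h => hj (h ▸ hi)
    simp [this]
  · by_cases hji : j = i
    · subst hji
      simpa using mul_self_nonneg _
    · simp [hji]
  · rw [EuclideanSpace.inner_single_right]
    simpa using saturatedSign_mul_self hx hi

theorem inner_saturatedSign_self {x : EuclideanSpace ℝ (Fin N)} (hx : x ≠ 0) :
    ⟪saturatedSign x, saturatedSign x⟫_ℝ = (saturationSupport x).card := by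
  rw [inner_eq_sum, ← Finset.sum_subset (Finset.subset_univ (saturationSupport x))
    (f := fun i => saturatedSign x i * saturatedSign x i)]
  · rw [Finset.card_eq_sum_ones, Nat.cast_sum, Nat.cast_one]
    exact Finset.sum_congr rfl fun i hi => saturatedSign_mul_self hx hi
  · intro i _ hi
    rw [saturatedSign_of_notMem hi, mul_zero]

theorem smul_saturatedSign_mem_modelSubspace {x : EuclideanSpace ℝ (Fin N)} (hx : x ≠ 0) (c : ℝ) :
    c • saturatedSign x ∈ modelSubspace linfNorm x := by
  refine Submodule.smul_mem _ _ (mem_modelSubspace_iff.2 fun u hu v hv => ?_)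
  rw [inner_sub_left, real_inner_comm, inner_saturatedSign_of_mem_subdifferential hx hu,
    real_inner_comm, inner_saturatedSign_of_mem_subdifferential hx hv, sub_self]

theorem modelVector_linfNorm (hN : 0 < N) {x : EuclideanSpace ℝ (Fin N)} (hx : x ≠ 0) :
    modelVector linfNorm x = ((saturationSupport x).card : ℝ)⁻¹ • saturatedSign x := by
  have hcard : (0 : ℝ) < (saturationSupport x).card :=
    Nat.cast_pos.2 (saturationSupport_nonempty hN x).card_pos
  refine modelVector_eq (subset_affineSpan ℝ _ ?_) (smul_saturatedSign_mem_modelSubspace hx _)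
  refine mem_subdifferential_of_nonneg hx (fun i hi => ?_) (fun i hi => ?_) ?_
  · simp [saturatedSign_of_notMem hi]
  · have h := saturatedSign_mul_self hx hi
    rw [PiLp.smul_apply, smul_eq_mul, mul_left_comm, h]
    positivity
  · rw [inner_smul_right, inner_saturatedSign_self hx, inv_mul_cancel₀ hcard.ne']

/-- Orthogonality to differences of vertices of the simplex makes `s_i τ_i` constant on the support.
-/
theorem exists_eq_mul_saturatedSign (hN : 0 < N) {x τ : EuclideanSpace ℝ (Fin N)} (hx : x ≠ 0)
    (hτ : τ ∈ modelSubspace linfNorm x) :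
    ∃ c : ℝ, ∀ i ∈ saturationSupport x, τ i = c * saturatedSign x i := by
  obtain ⟨j, hj⟩ := saturationSupport_nonempty hN x
  refine ⟨saturatedSign x j * τ j, fun i hi => ?_⟩
  have h := mem_modelSubspace_iff.1 hτ _ (single_saturatedSign_mem_subdifferential hx hi) _
    (single_saturatedSign_mem_subdifferential hx hj)
  rw [inner_sub_left, EuclideanSpace.inner_single_left, EuclideanSpace.inner_single_left] at h
  simp only [conj_trivial] at h
  linear_combination (-(τ i)) * saturatedSign_mul_self hx hi + saturatedSign x i * h

theorem map_eq_sum_single {F : Type*} [AddCommGroup F] [Module ℝ F]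
    (L : EuclideanSpace ℝ (Fin N) →ₗ[ℝ] F) (τ : EuclideanSpace ℝ (Fin N)) :
    L τ = ∑ i, τ i • L (EuclideanSpace.single i 1) := by
  conv_lhs => rw [← (EuclideanSpace.basisFun (Fin N) ℝ).sum_repr τ]
  simp

/-- At the origin the subdifferential contains `0` and every basis vector, so `T` is trivial, `e_x =
0` and the gauge is evaluated at `0`. -/
theorem linfIC_zero {Q : ℕ} (Φ : Matrix (Fin Q) (Fin N) ℝ) :
    RestrictedInjective (Matrix.toEuclideanLin Φ)
      (modelSubspace linfNorm (0 : EuclideanSpace ℝ (Fin N))) ∧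
    linfIC Φ (0 : EuclideanSpace ℝ (Fin N)) < 1 := by
  have h0 : (0 : EuclideanSpace ℝ (Fin N)) ∈ subdifferential linfNorm 0 := by
    intro y
    simpa [linfNorm_zero] using linfNorm_nonneg y
  have hT : modelSubspace linfNorm (0 : EuclideanSpace ℝ (Fin N)) = ⊥ := by
    rw [eq_bot_iff]
    intro τ hτ
    rw [Submodule.mem_bot]
    ext i
    have h1 : EuclideanSpace.single i (1 : ℝ) ∈ subdifferential linfNorm
        (0 : EuclideanSpace ℝ (Fin N)) := by
      intro y
      rw [linfNorm_zero, zero_add, sub_zero, EuclideanSpace.inner_single_left]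
      simpa using (le_abs_self _).trans (abs_le_linfNorm y i)
    have h2 := mem_modelSubspace_iff.1 hτ _ h1 _ h0
    rw [sub_zero, EuclideanSpace.inner_single_left] at h2
    simpa using h2
  have he : modelVector linfNorm (0 : EuclideanSpace ℝ (Fin N)) = 0 :=
    modelVector_eq (subset_affineSpan ℝ _ h0) (Submodule.zero_mem _)
  refine ⟨by rw [hT, RestrictedInjective, inf_bot_eq], ?_⟩
  rw [linfIC, irrepresentability, he]
  refine extGauge_lt_one (r := 1 / 2) (c := 0) (by norm_num) (by norm_num)
    ⟨0, h0, sub_zero _⟩ ?_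
  simp

variable {F : Type*} [NormedAddCommGroup F] [InnerProductSpace ℝ F] [FiniteDimensional ℝ F]

/-- The positivity assumption says that `L^* (P G)` lies in the open cone over the simplex;
normalised, it becomes `L^* w`, an interior point from which one can move slightly further away from
the barycentre. -/
theorem irrepresentability_linfNorm_lt_one (hN : 0 < N) {x : EuclideanSpace ℝ (Fin N)}
    (hx : x ≠ 0) (L : EuclideanSpace ℝ (Fin N) →ₗ[ℝ] F)
    (hli : LinearIndependent ℝ
      fun j : ↥(saturationSupport x)ᶜ => L (EuclideanSpace.single (j : Fin N) 1))
    (hpos : ∀ i ∈ saturationSupport x,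
      0 < ⟪(Submodule.span ℝ (Set.range fun j : ↥(saturationSupport x)ᶜ =>
          L (EuclideanSpace.single (j : Fin N) 1)))ᗮ.starProjection
            (saturatedSign x i • L (EuclideanSpace.single i 1)),
        ∑ j ∈ saturationSupport x, saturatedSign x j • L (EuclideanSpace.single j 1)⟫_ℝ) :
    RestrictedInjective L (modelSubspace linfNorm x) ∧
      irrepresentability linfNorm L x (modelVector linfNorm x) < 1 := by
  set I := saturationSupport x with hI
  set W := Submodule.span ℝ (Set.range fun j : ↥Iᶜ =>
          L (EuclideanSpace.single (j : Fin N) 1)) with hW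
  set G := ∑ j ∈ I, saturatedSign x j • L (EuclideanSpace.single j 1) with hG
  set P := Wᗮ.starProjection with hP
  have hcard : (0 : ℝ) < I.card :=
    Nat.cast_pos.2 (saturationSupport_nonempty hN x).card_pos
  obtain ⟨i₀, hi₀⟩ := saturationSupport_nonempty hN x
  have hPG : P G ≠ 0 := by
    intro h
    have := hpos i₀ hi₀
    rw [hP, Submodule.inner_starProjection_left_eq_right, ← hP, h, inner_zero_right] at this
    exact lt_irrefl _ this
  have hLG : L (saturatedSign x) = G := by
    rw [map_eq_sum_single, hG, ← Finset.sum_subset (Finset.subset_univ I)]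
    intro i _ hi
    rw [saturatedSign_of_notMem hi, zero_smul]
  have hPW : ∀ j ∉ I, L (EuclideanSpace.single j 1) ∈ W := fun j hj =>
    Submodule.subset_span ⟨⟨j, Finset.mem_compl.2 hj⟩, rfl⟩
  have hdecomp : ∀ τ ∈ modelSubspace linfNorm x, ∃ c : ℝ,
      (∀ i ∈ I, τ i = c * saturatedSign x i) ∧
      L τ = c • G + ∑ j ∈ Iᶜ, τ j • L (EuclideanSpace.single j 1) := by
    intro τ hτ
    obtain ⟨c, hc⟩ := exists_eq_mul_saturatedSign hN hx hτ
    refine ⟨c, hc, ?_⟩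
    rw [map_eq_sum_single, ← Finset.sum_add_sum_compl I, hG, Finset.smul_sum]
    congr 1
    refine Finset.sum_congr rfl fun i hi => ?_
    rw [hc i hi, mul_smul]
  have hPL : ∀ τ : EuclideanSpace ℝ (Fin N),
      P (∑ j ∈ Iᶜ, τ j • L (EuclideanSpace.single j 1)) = 0 := by
    intro τ
    rw [hP, Submodule.starProjection_apply_eq_zero_iff, Submodule.orthogonal_orthogonal]
    exact Submodule.sum_mem _ fun j hj => Submodule.smul_mem _ _ (hPW j (Finset.mem_compl.1 hj))
  have hinj : RestrictedInjective L (modelSubspace linfNorm x) := by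
    rw [RestrictedInjective, eq_bot_iff]
    rintro τ ⟨hker, hτ⟩
    obtain ⟨c, hc, hL⟩ := hdecomp τ hτ
    have hker : L τ = 0 := hker
    have h1 : c • P G = 0 := by
      have := congrArg P hL
      rw [hker, map_zero, map_add, hPL, add_zero, map_smul] at this
      exact this.symm
    have hc0 : c = 0 := (smul_eq_zero.1 h1).resolve_right hPG
    rw [hker, hc0, zero_smul, zero_add] at hL
    rw [Submodule.mem_bot]
    ext i
    by_cases hi : i ∈ I
    · simp [hc i hi, hc0]
    · rw [← Finset.sum_coe_sort] at hL
      exact Fintype.linearIndependent_iff.1 hli (fun j => τ j) hL.symm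
        ⟨i, Finset.mem_compl.2 hi⟩
  refine ⟨hinj, ?_⟩
  set e := modelVector linfNorm x with he
  have he' : e = (I.card : ℝ)⁻¹ • saturatedSign x := modelVector_linfNorm hN hx
  have heT : e ∈ modelSubspace linfNorm x := by
    rw [he']; exact smul_saturatedSign_mem_modelSubspace hx _
  obtain ⟨w, hw⟩ : ∃ w, w = LinearMap.adjoint (pinv (restrictTo L (modelSubspace linfNorm x))) e :=
    ⟨_, rfl⟩
  have hPe := starProjection_adjoint_adjoint_pinv hinj heT
  rw [← hw] at hPe
  have hinnerT : ∀ τ ∈ modelSubspace linfNorm x, ⟪w, L τ⟫_ℝ = ⟪e, τ⟫_ℝ := by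
    intro τ hτ
    rw [← LinearMap.adjoint_inner_left, ← hPe, Submodule.inner_starProjection_left_eq_right,
      Submodule.starProjection_eq_self_iff.2 hτ]
  have hsingleT : ∀ j ∉ I, EuclideanSpace.single j (1 : ℝ) ∈ modelSubspace linfNorm x := by
    intro j hj
    refine mem_modelSubspace_iff.2 fun u hu v hv => ?_
    rw [EuclideanSpace.inner_single_right, PiLp.sub_apply, eq_zero_of_mem_subdifferential hu hj,
      eq_zero_of_mem_subdifferential hv hj]
    simp
  have hwoff : ∀ j ∉ I, ⟪w, L (EuclideanSpace.single j 1)⟫_ℝ = 0 := by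
    intro j hj
    rw [hinnerT _ (hsingleT j hj), EuclideanSpace.inner_single_right, he']
    simp [saturatedSign_of_notMem hj]
  have hwG : ⟪w, G⟫_ℝ = 1 := by
    have hs : saturatedSign x ∈ modelSubspace linfNorm x := by
      simpa using smul_saturatedSign_mem_modelSubspace hx 1
    rw [← hLG, hinnerT _ hs, he', real_inner_smul_left, inner_saturatedSign_self hx,
      inv_mul_cancel₀ hcard.ne']
  obtain ⟨τ, hτ, hwτ⟩ : ∃ τ ∈ modelSubspace linfNorm x, w = L τ := by
    obtain ⟨u, hu⟩ := adjoint_pinv_mem_range (restrictTo L (modelSubspace linfNorm x)) e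
    exact ⟨_, Submodule.starProjection_apply_mem _ u, by rw [hw, ← hu]; rfl⟩
  obtain ⟨c, -, hL⟩ := hdecomp τ hτ
  -- Being orthogonal to `W`, `w` is fixed by `P`, and `P` removes the off-support part of `L τ`.
  have hwc : w = c • P G := by
    have hwW : w ∈ Wᗮ := by
      rw [hW, Submodule.mem_orthogonal']
      intro z hz
      induction hz using Submodule.span_induction with
      | mem z hz =>
        obtain ⟨j, rfl⟩ := hz
        exact hwoff j (Finset.mem_compl.1 j.2)
      | zero => exact inner_zero_right _
      | add a b _ _ ha hb => rw [inner_add_right, ha, hb, add_zero]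
      | smul r a _ ha => rw [inner_smul_right, ha, mul_zero]
    have h1 : P w = w := Submodule.starProjection_eq_self_iff.2 hwW
    rw [← h1, hwτ, hL, map_add, hPL, add_zero, map_smul]
  have hc : 0 < c := by
    have h1 : c * ⟪P G, G⟫_ℝ = 1 := by rw [← real_inner_smul_left, ← hwc, hwG]
    have h2 : 0 ≤ ⟪P G, G⟫_ℝ := by
      have : ⟪P G, G⟫_ℝ = ⟪P G, P G⟫_ℝ := by
        conv_lhs => rw [hP, ← Submodule.isIdempotentElem_starProjection Wᗮ]
        exact Submodule.inner_starProjection_left_eq_right _ _ _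
      rw [this]
      exact real_inner_self_nonneg
    by_contra hneg
    nlinarith [mul_nonneg (sub_nonneg.2 (not_lt.1 hneg)) h2]
  have hwpos : ∀ i ∈ I, 0 < saturatedSign x i * ⟪w, L (EuclideanSpace.single i 1)⟫_ℝ := by
    intro i hi
    have := mul_pos hc (hpos i hi)
    rwa [real_inner_comm, ← Submodule.inner_starProjection_left_eq_right, ← hP,
      ← real_inner_smul_left, ← hwc, inner_smul_right] at this
  obtain ⟨v, hv⟩ : ∃ v, v = LinearMap.adjoint L w := ⟨_, rfl⟩
  have hvi : ∀ i, v i = ⟪w, L (EuclideanSpace.single i 1)⟫_ℝ := by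
    intro i
    rw [← LinearMap.adjoint_inner_left, ← hv, EuclideanSpace.inner_single_right]
    simp
  obtain ⟨δ, hδ, hδle⟩ : ∃ δ : ℝ, 0 < δ ∧ ∀ i ∈ I, δ ≤ saturatedSign x i * v i := by
    obtain ⟨i₁, hi₁, hmin⟩ := Finset.exists_min_image I (fun i => saturatedSign x i * v i) ⟨i₀, hi₀⟩
    exact ⟨_, by simpa only [hvi] using hwpos i₁ hi₁, hmin⟩
  -- The barycentric coordinates of `e + r⁻¹ (v - e)` are `r⁻¹ (s_i v_i - (1 - r) / |I|)`; they are
  -- nonnegative once `1 - r ≤ |I| δ`.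
  obtain ⟨r, hr0, hr1, hrδ⟩ : ∃ r : ℝ, 0 < r ∧ r < 1 ∧ 1 - r ≤ I.card * δ := by
    refine ⟨max (1 / 2) (1 - I.card * δ), by positivity, max_lt (by norm_num) ?_, ?_⟩
    · nlinarith
    · linarith [le_max_right (1 / 2) (1 - I.card * δ)]
  rw [irrepresentability, ← hw, irrepresentability_argument hinj heT w hw, ← hv]
  refine extGauge_lt_one hr0 hr1 (c := r⁻¹ • (v - e)) ⟨e + r⁻¹ • (v - e), ?_, by simp⟩
    (by rw [smul_inv_smul₀ hr0.ne'])
  have hei : ∀ i, e i = (I.card : ℝ)⁻¹ * saturatedSign x i := fun i => by rw [he']; rfl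
  refine mem_subdifferential_of_nonneg hx (fun i hi => ?_) (fun i hi => ?_) ?_
  · have h1 : v i = 0 := by rw [hvi, hwoff i hi]
    simp [hei, h1, saturatedSign_of_notMem hi]
  · have h1 : saturatedSign x i * (e + r⁻¹ • (v - e)) i
        = r⁻¹ * ((I.card : ℝ)⁻¹ * (r - 1) + saturatedSign x i * v i) := by
      simp only [PiLp.add_apply, PiLp.smul_apply, PiLp.sub_apply, smul_eq_mul, hei]
      have h2 := saturatedSign_mul_self hx hi
      field_simp
      linear_combination (r - 1) * h2
    rw [h1]
    have h3 : (I.card : ℝ)⁻¹ * (1 - r) ≤ δ := by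
      rw [inv_mul_le_iff₀ hcard]
      exact hrδ
    have h4 := hδle i hi
    have : 0 ≤ (I.card : ℝ)⁻¹ * (r - 1) + saturatedSign x i * v i := by nlinarith
    positivity
  · have h1 : ⟪saturatedSign x, e⟫_ℝ = 1 := by
      rw [he', inner_smul_right, inner_saturatedSign_self hx, inv_mul_cancel₀ hcard.ne']
    have h2 : ⟪saturatedSign x, v⟫_ℝ = 1 := by
      rw [hv, LinearMap.adjoint_inner_right, hLG, real_inner_comm, hwG]
    rw [inner_add_right, inner_smul_right, inner_sub_right, h1, h2]
    simp

end LinfNorm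

/-! ### Gaussian integrals, and measurability of the residual after projection. -/

section Gaussian

variable {E : Type*} [NormedAddCommGroup E] [InnerProductSpace ℝ E] [FiniteDimensional ℝ E]
  [MeasurableSpace E] [BorelSpace E]

theorem map_inner_stdGaussian (z : E) :
    (stdGaussian E).map (fun a => ⟪z, a⟫_ℝ) = gaussianReal 0 (‖z‖ ^ 2).toNNReal := by
  have h := IsGaussian.map_eq_gaussianReal (μ := stdGaussian E) (innerSL ℝ z)
  rw [integral_strongDual_stdGaussian, variance_dual_stdGaussian, innerSL_apply_norm] at h
  exact h

theorem stdGaussian_submodule_eq_zero {W : Submodule ℝ E} (hW : W ≠ ⊤) :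
    stdGaussian E (W : Set E) = 0 := by
  obtain ⟨z, hz, hz0⟩ : ∃ z ∈ Wᗮ, z ≠ 0 :=
    Submodule.exists_mem_ne_zero_of_ne_bot fun h => hW (Submodule.orthogonal_eq_bot_iff.1 h)
  have hsub : (W : Set E) ⊆ (fun a => ⟪z, a⟫_ℝ) ⁻¹' {0} := fun a ha =>
    (Submodule.mem_orthogonal' _ _).1 hz a ha
  refine measure_mono_null hsub ?_
  rw [← Measure.map_apply (by fun_prop) (measurableSet_singleton 0), map_inner_stdGaussian]
  have hv : (‖z‖ ^ 2).toNNReal ≠ 0 := by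
    have : 0 < ‖z‖ ^ 2 := by positivity
    exact (Real.toNNReal_pos.2 this).ne'
  have := nullSingletonClass_gaussianReal (μ := 0) hv
  exact measure_singleton 0

theorem map_orthogonalProjectionOnto_stdGaussian (V : Submodule ℝ E) :
    (stdGaussian E).map V.orthogonalProjectionOnto = stdGaussian V := by
  apply Measure.ext_of_charFun
  ext t
  rw [charFun_stdGaussian, charFun_apply, integral_map (by fun_prop) (by fun_prop)]
  have h := charFun_stdGaussian (t : E)
  rw [charFun_apply] at h
  simp only [Submodule.inner_orthogonalProjectionOnto_eq_of_mem_right]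
  rw [h, Submodule.coe_norm]

theorem integral_exp_neg_mul_sq_gaussianReal {θ : ℝ} (hθ : 0 ≤ θ) :
    ∫ y, Real.exp (-(θ / 2) * y ^ 2) ∂(gaussianReal 0 1) = (√(1 + θ))⁻¹ := by
  rw [integral_gaussianReal_eq_integral_smul one_ne_zero]
  have h : ∀ y : ℝ, gaussianPDFReal 0 1 y • Real.exp (-(θ / 2) * y ^ 2)
      = (√(2 * Real.pi))⁻¹ * Real.exp (-((1 + θ) / 2) * y ^ 2) := by
    intro y
    rw [gaussianPDFReal_def]
    simp only [NNReal.coe_one, mul_one, sub_zero, smul_eq_mul, mul_assoc, ← Real.exp_add]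
    congr 2
    ring
  simp_rw [h]
  rw [integral_const_mul, integral_gaussian, ← Real.sqrt_inv, ← Real.sqrt_mul (by positivity),
    ← Real.sqrt_inv]
  congr 1
  have := Real.pi_pos
  field_simp

theorem integral_exp_neg_mul_norm_sq_stdGaussian {θ : ℝ} (hθ : 0 ≤ θ) :
    ∫ a, Real.exp (-(θ / 2) * ‖a‖ ^ 2) ∂(stdGaussian E)
      = (√(1 + θ))⁻¹ ^ Module.finrank ℝ E := by
  rw [stdGaussian, integral_map (Measurable.aemeasurable (by fun_prop)) (by fun_prop)]
  have h : ∀ y : Fin (Module.finrank ℝ E) → ℝ,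
      Real.exp (-(θ / 2) * ‖∑ i, y i • stdOrthonormalBasis ℝ E i‖ ^ 2)
        = ∏ i, Real.exp (-(θ / 2) * y i ^ 2) := by
    intro y
    rw [← Real.exp_sum, ← Finset.mul_sum, ← real_inner_self_eq_norm_sq,
      (stdOrthonormalBasis ℝ E).orthonormal.inner_sum]
    simp [sq]
  simp_rw [h]
  rw [integral_fintype_prod_eq_prod (f := fun _ y => Real.exp (-(θ / 2) * y ^ 2))]
  simp_rw [integral_exp_neg_mul_sq_gaussianReal hθ]
  simp

/-- Laplace transform of a chi-squared variable: the projection of a standard Gaussian onto `V` is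
standard Gaussian in `V`. -/
theorem lintegral_exp_neg_mul_norm_sq_starProjection (V : Submodule ℝ E) {θ : ℝ} (hθ : 0 ≤ θ) :
    ∫⁻ a, ENNReal.ofReal (Real.exp (-(θ / 2) * ‖V.starProjection a‖ ^ 2)) ∂(stdGaussian E)
      = ENNReal.ofReal ((√(1 + θ))⁻¹ ^ Module.finrank ℝ V) := by
  have hint := integral_exp_neg_mul_norm_sq_stdGaussian (E := V) hθ
  -- A nonzero Bochner integral yields integrability with no separate estimate.
  have hpos : (0 : ℝ) < (√(1 + θ))⁻¹ ^ Module.finrank ℝ V := by positivity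
  rw [← hint, ofReal_integral_eq_lintegral_ofReal
    (Integrable.of_integral_ne_zero (by rw [hint]; exact hpos.ne'))
    (Filter.Eventually.of_forall fun _ => (Real.exp_pos _).le),
    ← map_orthogonalProjectionOnto_stdGaussian V, lintegral_map (by fun_prop) (by fun_prop)]
  rfl

variable {ι : Type*} [Fintype ι]

theorem lintegral_exp_inner_sum_pi_stdGaussian (K : Finset ι) {s : ι → ℝ}
    (hs : ∀ j ∈ K, s j * s j = 1) (z : E) :
    ∫⁻ x, ENNReal.ofReal (Real.exp ⟪z, ∑ j ∈ K, s j • x j⟫_ℝ)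
        ∂(Measure.pi fun _ : ι => stdGaussian E)
      = ENNReal.ofReal (Real.exp (K.card * (‖z‖ ^ 2 / 2))) := by
  set ν := Measure.pi fun _ : ι => stdGaussian E with hν
  have hind : iIndepFun (fun (j : ι) (x : ι → E) => ⟪s j • z, x j⟫_ℝ) ν :=
    iIndepFun_pi (X := fun j a => ⟪s j • z, a⟫_ℝ) fun j => by fun_prop
  have hmgf : ∀ j ∈ K, mgf (fun x : ι → E => ⟪s j • z, x j⟫_ℝ) ν 1
      = Real.exp (‖z‖ ^ 2 / 2) := by
    intro j hj
    have hlaw : ν.map (fun x : ι → E => ⟪s j • z, x j⟫_ℝ)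
        = gaussianReal 0 (‖s j • z‖ ^ 2).toNNReal := by
      rw [← map_inner_stdGaussian, ← (measurePreserving_eval (fun _ : ι => stdGaussian E) j).map_eq,
        Measure.map_map (by fun_prop) (by fun_prop)]
      rfl
    rw [mgf_gaussianReal hlaw, Real.coe_toNNReal _ (by positivity), norm_smul, mul_pow,
      Real.norm_eq_abs, sq_abs, sq (s j), hs j hj]
    simp
  have hsum := hind.mgf_sum (t := 1) (fun j => by fun_prop) K
  rw [Finset.prod_congr rfl hmgf, Finset.prod_const, ← Real.exp_nat_mul] at hsum
  have hfun : ∀ x : ι → E, (1 : ℝ) * (∑ j ∈ K, fun x : ι → E => ⟪s j • z, x j⟫_ℝ) x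
      = ⟪z, ∑ j ∈ K, s j • x j⟫_ℝ := by
    intro x
    rw [one_mul, Finset.sum_apply, inner_sum]
    exact Finset.sum_congr rfl fun j _ => by rw [real_inner_smul_left, inner_smul_right]
  simp only [mgf, hfun] at hsum
  rw [← hsum, ofReal_integral_eq_lintegral_ofReal
    (Integrable.of_integral_ne_zero (by rw [hsum]; exact (Real.exp_pos _).ne'))
    (Filter.Eventually.of_forall fun _ => (Real.exp_pos _).le)]

/-- Conditioning on `U` in the form of Fubini: by independence, `V` may be replaced by an
independent copy. -/
theorem lintegral_prodMk_of_indepFun {Ω β γ : Type*} [MeasurableSpace Ω] [MeasurableSpace β]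
    [MeasurableSpace γ] {μ : Measure Ω} [IsProbabilityMeasure μ] {U : Ω → β} {V : Ω → γ}
    (h : IndepFun U V μ) (hU : Measurable U) (hV : Measurable V) {f : β × γ → ℝ≥0∞}
    (hf : Measurable f) :
    ∫⁻ ω, f (U ω, V ω) ∂μ = ∫⁻ ω, ∫⁻ ω', f (U ω, V ω') ∂μ ∂μ := by
  have := Measure.isProbabilityMeasure_map (μ := μ) hV.aemeasurable
  rw [← lintegral_map (f := f) (g := fun ω => (U ω, V ω)) hf (hU.prodMk hV),
    (indepFun_iff_map_prod_eq_prod_map_map hU.aemeasurable hV.aemeasurable).1 h,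
    lintegral_prod _ hf.aemeasurable, lintegral_map hf.lintegral_prod_right' hU]
  refine lintegral_congr fun ω => ?_
  rw [lintegral_map (by fun_prop) hV]

/-- The inner product of the residual of `a` after projection onto the span of `y` with `b`. -/
def residualInner {κ : Type*} (y : κ → E) (a b : E) : ℝ :=
  ⟪(Submodule.span ℝ (Set.range y))ᗮ.starProjection a, b⟫_ℝ

theorem residualInner_self {κ : Type*} (y : κ → E) (a : E) :
    residualInner y a a = ‖(Submodule.span ℝ (Set.range y))ᗮ.starProjection a‖ ^ 2 := by
  rw [residualInner, ← real_inner_self_eq_norm_sq]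
  conv_lhs => rw [← Submodule.isIdempotentElem_starProjection (Submodule.span ℝ (Set.range y))ᗮ]
  exact Submodule.inner_starProjection_left_eq_right _ _ _

theorem residualInner_comm {κ : Type*} (y : κ → E) (a b : E) :
    residualInner y a b = residualInner y b a := by
  rw [residualInner, Submodule.inner_starProjection_left_eq_right, real_inner_comm, residualInner]

/-- The projector is not continuous where the rank of the family drops, but the distance to the span
is an infimum, over fixed coefficients, of continuous functions, hence upper semicontinuous. -/
theorem measurable_norm_residual {κ : Type*} [Fintype κ] :
    Measurable fun p : (κ → E) × E =>
      ‖(Submodule.span ℝ (Set.range p.1))ᗮ.starProjection p.2‖ := by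
  refine measurable_of_Iio fun r => IsOpen.measurableSet ?_
  have h : (fun p : (κ → E) × E => ‖(Submodule.span ℝ (Set.range p.1))ᗮ.starProjection p.2‖)
        ⁻¹' Set.Iio r = ⋃ c : κ → ℝ, {p | ‖p.2 - ∑ j, c j • p.1 j‖ < r} := by
    ext ⟨y, a⟩
    have hn : ‖(Submodule.span ℝ (Set.range y))ᗮ.starProjection a‖
        = ⨅ u : Submodule.span ℝ (Set.range y), ‖a - u‖ := by
      rw [← Submodule.starProjection_minimal, Submodule.starProjection_orthogonal_val]
    simp only [Set.mem_preimage, Set.mem_Iio, Set.mem_iUnion, Set.mem_ofPred_eq]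
    constructor
    · intro hlt
      rw [hn] at hlt
      obtain ⟨⟨u, hu⟩, hur⟩ := exists_lt_of_ciInf_lt hlt
      obtain ⟨c, rfl⟩ := (Submodule.mem_span_range_iff_exists_fun ℝ).1 hu
      exact ⟨c, hur⟩
    · rintro ⟨c, hc⟩
      rw [hn]
      refine lt_of_le_of_lt (ciInf_le ⟨0, ?_⟩
        (⟨_, (Submodule.mem_span_range_iff_exists_fun ℝ).2 ⟨c, rfl⟩⟩ :
          Submodule.span ℝ (Set.range y))) hc
      rintro _ ⟨u, rfl⟩
      exact norm_nonneg _
  rw [h]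
  exact isOpen_iUnion fun c => isOpen_lt (by fun_prop) continuous_const

theorem measurable_residualInner {κ : Type*} [Fintype κ] :
    Measurable fun p : ((κ → E) × E) × E => residualInner p.1.1 p.1.2 p.2 := by
  -- Polarisation reduces the bilinear expression to residual norms.
  have hpol : ∀ p : ((κ → E) × E) × E, residualInner p.1.1 p.1.2 p.2
      = (‖(Submodule.span ℝ (Set.range p.1.1))ᗮ.starProjection (p.1.2 + p.2)‖ ^ 2
        - ‖(Submodule.span ℝ (Set.range p.1.1))ᗮ.starProjection (p.1.2 - p.2)‖ ^ 2) / 4 := by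
    rintro ⟨⟨y, a⟩, b⟩
    rw [← residualInner_self, ← residualInner_self]
    have h1 := residualInner_comm y a b
    simp only [residualInner, map_add, map_sub, inner_add_left, inner_add_right, inner_sub_left,
      inner_sub_right] at h1 ⊢
    linarith
  simp_rw [hpol]
  have h1 : Measurable fun p : ((κ → E) × E) × E => (p.1.1, p.1.2 + p.2) := by fun_prop
  have h2 : Measurable fun p : ((κ → E) × E) × E => (p.1.1, p.1.2 - p.2) := by fun_prop
  exact (((measurable_norm_residual.comp h1).pow_const 2).sub
    ((measurable_norm_residual.comp h2).pow_const 2)).div_const 4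

end Gaussian

/-! ### Families of independent Gaussian vectors: generic independence and the tail bound. -/

section GaussianFamily

variable {E : Type*} [NormedAddCommGroup E] [InnerProductSpace ℝ E] [FiniteDimensional ℝ E]
  [MeasurableSpace E] [BorelSpace E] {ι : Type*} [Fintype ι] [DecidableEq ι]

theorem iIndepFun_eval_pi_stdGaussian :
    iIndepFun (fun (j : ι) (x : ι → E) => x j) (Measure.pi fun _ : ι => stdGaussian E) :=
  iIndepFun_pi (X := fun _ a => a) fun _ => aemeasurable_id

theorem map_eval_pi_stdGaussian (j : ι) :
    (Measure.pi fun _ : ι => stdGaussian E).map (fun x => x j) = stdGaussian E :=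
  (measurePreserving_eval (fun _ : ι => stdGaussian E) j).map_eq

theorem indepFun_restrict_eval {s : Finset ι} {i : ι} (hi : i ∉ s) :
    IndepFun (fun (x : ι → E) (j : s) => x j) (fun x => x i)
      (Measure.pi fun _ : ι => stdGaussian E) :=
  (iIndepFun_eval_pi_stdGaussian.indepFun_finset s {i} (Finset.disjoint_singleton_right.2 hi)
    fun j => measurable_pi_apply j).comp (φ := id)
    (ψ := fun v : ({i} : Finset ι) → E => v ⟨i, Finset.mem_singleton_self i⟩)
    measurable_id (measurable_pi_apply _)

theorem indepFun_restrict_compl_sum (I : Finset ι) (i : ι) (s : ι → ℝ) :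
    IndepFun (fun x : ι → E => ((fun j : ↥Iᶜ => x j), x i))
      (fun x => ∑ j ∈ I.erase i, s j • x j) (Measure.pi fun _ : ι => stdGaussian E) := by
  have hdisj : Disjoint (insert i Iᶜ) (I.erase i) := by
    rw [Finset.disjoint_left]
    intro j hj hj'
    rw [Finset.mem_insert, Finset.mem_compl] at hj
    rw [Finset.mem_erase] at hj'
    exact hj.elim hj'.1 fun h => h hj'.2
  have h := (iIndepFun_eval_pi_stdGaussian (E := E).indepFun_finset _ _ hdisj
    fun j => measurable_pi_apply j).comp
    (φ := fun u => ((fun j : ↥Iᶜ => u ⟨j, Finset.mem_insert_of_mem j.2⟩),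
      u ⟨i, Finset.mem_insert_self i _⟩))
    (ψ := fun v => ∑ j : ↥(I.erase i), s j • v j) (by fun_prop) (by fun_prop)
  convert! h using 1
  ext1 x
  exact (Finset.sum_coe_sort (I.erase i) fun j => s j • x j).symm

/-- Each new vector is independent of the previous ones, whose span is proper by dimension count and
therefore Gaussian-null. -/
theorem ae_linearIndependent_pi_stdGaussian (s : Finset ι) (hs : s.card ≤ Module.finrank ℝ E) :
    ∀ᵐ x ∂(Measure.pi fun _ : ι => stdGaussian E), LinearIndependent ℝ fun j : s => x j := by
  induction s using Finset.induction_on with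
  | empty => exact Filter.Eventually.of_forall fun x => linearIndependent_empty_type
  | insert a s ha ih =>
    rw [Finset.card_insert_of_notMem ha] at hs
    have hnull : ∀ᵐ x ∂(Measure.pi fun _ : ι => stdGaussian E),
        x a ∉ Submodule.span ℝ (Set.range fun j : s => x j) := by
      have hA : MeasurableSet {p : (s → E) × E | p.2 ∈ Submodule.span ℝ (Set.range p.1)} := by
        have : {p : (s → E) × E | p.2 ∈ Submodule.span ℝ (Set.range p.1)}
            = (fun p : (s → E) × E =>
              ‖(Submodule.span ℝ (Set.range p.1))ᗮ.starProjection p.2‖) ⁻¹' {0} := by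
          ext p
          rw [Set.mem_preimage, Set.mem_singleton_iff, norm_eq_zero,
            Submodule.starProjection_apply_eq_zero_iff, Submodule.orthogonal_orthogonal]
          rfl
        rw [this]
        exact measurable_norm_residual (measurableSet_singleton 0)
      have hlaw := (indepFun_iff_map_prod_eq_prod_map_map (Measurable.aemeasurable (by fun_prop))
        (Measurable.aemeasurable (by fun_prop))).1 (indepFun_restrict_eval (E := E) ha)
      rw [map_eval_pi_stdGaussian] at hlaw
      rw [ae_iff]
      simp only [not_not]
      change (Measure.pi fun _ : ι => stdGaussian E)
        ((fun x : ι → E => ((fun j : s => x j), x a)) ⁻¹'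
          {p : (s → E) × E | p.2 ∈ Submodule.span ℝ (Set.range p.1)}) = 0
      rw [← Measure.map_apply (by fun_prop) hA, hlaw, Measure.measure_prod_null hA]
      refine Filter.Eventually.of_forall fun y => ?_
      change stdGaussian E (Submodule.span ℝ (Set.range y) : Set E) = 0
      refine stdGaussian_submodule_eq_zero fun htop => ?_
      have h1 := finrank_range_le_card (R := ℝ) y
      rw [Set.finrank, htop, finrank_top, Fintype.card_coe] at h1
      omega
    filter_upwards [ih (by omega), hnull] with x hx hxa
    have h1 : LinearIndepOn ℝ x (s : Set ι) := hx
    have h2 : x a ∉ Submodule.span ℝ (x '' (s : Set ι)) := by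
      rwa [Set.image_eq_range]
    have h3 := (linearIndepOn_insert (Finset.mem_coe.not.2 ha)).2 ⟨h1, h2⟩
    rw [← Finset.coe_insert] at h3
    exact h3

/-- With the projected vector frozen, the linear term has variance `|K| ‖P a‖²`, so the exponent is
`(-t + |K| t² / 2) ‖P a‖²`. The choice `t = 1 / |K|` minimises it, with value `-(t / 2) ‖P a‖²`. -/
theorem lintegral_exp_neg_residualInner_add_sum {κ : Type*} {K : Finset ι} {s : ι → ℝ}
    (hs : ∀ j ∈ K, s j * s j = 1) {c t : ℝ} (hc : c * c = 1) (ht : K.card * t = 1)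
    (y : κ → E) (a : E) :
    ∫⁻ x, ENNReal.ofReal (Real.exp (-t *
        residualInner y (c • a) (c • a + ∑ j ∈ K, s j • x j)))
        ∂(Measure.pi fun _ : ι => stdGaussian E)
      = ENNReal.ofReal (Real.exp (-(t / 2) *
        ‖(Submodule.span ℝ (Set.range y))ᗮ.starProjection a‖ ^ 2)) := by
  have hmgf := lintegral_exp_inner_sum_pi_stdGaussian (E := E) K hs
    (-(t * c) • (Submodule.span ℝ (Set.range y))ᗮ.starProjection a)
  have hexp : ∀ b : E, Real.exp (-t * residualInner y (c • a) (c • a + b))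
      = Real.exp (-t * ‖(Submodule.span ℝ (Set.range y))ᗮ.starProjection a‖ ^ 2)
        * Real.exp
          ⟪-(t * c) • (Submodule.span ℝ (Set.range y))ᗮ.starProjection a, b⟫_ℝ := by
    intro b
    have h1 := residualInner_self y a
    rw [residualInner] at h1
    rw [← Real.exp_add, residualInner, map_smul, inner_add_right, real_inner_smul_left,
      real_inner_smul_left, real_inner_smul_left, inner_smul_right, h1]
    congr 1
    linear_combination (-t * ‖(Submodule.span ℝ (Set.range y))ᗮ.starProjection a‖ ^ 2) * hc
  simp_rw [hexp, ENNReal.ofReal_mul (Real.exp_pos _).le]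
  rw [lintegral_const_mul' _ _ ENNReal.ofReal_ne_top, hmgf,
    ← ENNReal.ofReal_mul (Real.exp_pos _).le, ← Real.exp_add, norm_smul, mul_pow,
    Real.norm_eq_abs, sq_abs]
  congr 2
  linear_combination
    (‖(Submodule.span ℝ (Set.range y))ᗮ.starProjection a‖ ^ 2 * t / 2) * (c * c) * ht
    + (‖(Submodule.span ℝ (Set.range y))ᗮ.starProjection a‖ ^ 2 * t / 2) * hc

/-- Two successive conditionings: the sum over `I.erase i` is integrated first, then the vector of
index `i`, with the span of the off-support vectors fixed. -/
theorem lintegral_exp_neg_residualInner_le {I : Finset ι} {i : ι} (hi : i ∈ I) {s : ι → ℝ}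
    (hs : ∀ j ∈ I, s j * s j = 1) (hI : 2 ≤ I.card) {d : ℕ}
    (hd : d + Fintype.card ι ≤ Module.finrank ℝ E + I.card) :
    ∫⁻ x, ENNReal.ofReal (Real.exp (-((I.card : ℝ) - 1)⁻¹ *
        residualInner (fun j : ↥Iᶜ => x j) (s i • x i) (∑ j ∈ I, s j • x j)))
        ∂(Measure.pi fun _ : ι => stdGaussian E)
      ≤ ENNReal.ofReal ((√(1 + ((I.card : ℝ) - 1)⁻¹))⁻¹ ^ d) := by
  set ν := Measure.pi fun _ : ι => stdGaussian E with hν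
  have hk : (0 : ℝ) < (I.card : ℝ) - 1 := by
    have : (2 : ℝ) ≤ I.card := by exact_mod_cast hI
    linarith
  set t := ((I.card : ℝ) - 1)⁻¹ with ht
  have ht0 : 0 < t := inv_pos.2 hk
  have hcard : (((I.erase i).card : ℕ) : ℝ) = (I.card : ℝ) - 1 := by
    rw [Finset.card_erase_of_mem hi, Nat.cast_sub (by omega), Nat.cast_one]
  have hsplit : ∀ x : ι → E, ∑ j ∈ I, s j • x j = s i • x i + ∑ j ∈ I.erase i, s j • x j :=
    fun x => (Finset.add_sum_erase I (fun j => s j • x j) hi).symm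
  have hinner := fun (y : ↥Iᶜ → E) (a : E) =>
    lintegral_exp_neg_residualInner_add_sum (K := I.erase i) (t := t)
      (fun j hj => hs j (Finset.mem_of_mem_erase hj)) (hs i hi)
      (by rw [hcard, ht, mul_inv_cancel₀ hk.ne']) y a
  have hmeas1 : Measurable fun p : ((↥Iᶜ → E) × E) × E => ENNReal.ofReal (Real.exp (-t *
      residualInner p.1.1 (s i • p.1.2) (s i • p.1.2 + p.2))) := by
    have h1 : Measurable fun p : ((↥Iᶜ → E) × E) × E =>
        ((p.1.1, s i • p.1.2), s i • p.1.2 + p.2) := by fun_prop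
    have h2 := measurable_residualInner.comp h1
    exact (h2.const_mul (-t)).exp.ennreal_ofReal
  have hmeas2 : Measurable fun p : (↥Iᶜ → E) × E => ENNReal.ofReal (Real.exp (-(t / 2) *
      ‖(Submodule.span ℝ (Set.range p.1))ᗮ.starProjection p.2‖ ^ 2)) :=
    ((measurable_norm_residual.pow_const 2).const_mul (-(t / 2))).exp.ennreal_ofReal
  simp_rw [hsplit]
  have hfub1 := lintegral_prodMk_of_indepFun (indepFun_restrict_compl_sum (E := E) I i s)
    (by fun_prop) (by fun_prop) hmeas1
  have hfub2 := lintegral_prodMk_of_indepFun (indepFun_restrict_eval (E := E) (s := Iᶜ) (i := i)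
    (by simpa using hi)) (by fun_prop) (by fun_prop) hmeas2
  simp only [hinner] at hfub1
  rw [hfub1, hfub2]
  have hbound : ∀ x : ι → E, ∫⁻ x' : ι → E, ENNReal.ofReal (Real.exp (-(t / 2) *
      ‖(Submodule.span ℝ (Set.range fun j : ↥Iᶜ => x j))ᗮ.starProjection (x' i)‖ ^ 2)) ∂ν
      ≤ ENNReal.ofReal ((√(1 + t))⁻¹ ^ d) := by
    intro x
    rw [← lintegral_map (μ := ν) (g := fun x' : ι → E => x' i)
      (f := fun a => ENNReal.ofReal (Real.exp (-(t / 2) *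
      ‖(Submodule.span ℝ (Set.range fun j : ↥Iᶜ => x j))ᗮ.starProjection a‖ ^ 2)))
      (by fun_prop) (by fun_prop), hν, map_eval_pi_stdGaussian,
      lintegral_exp_neg_mul_norm_sq_starProjection _ ht0.le]
    -- The orthogonal complement has dimension at least `d`, whatever the rank of the off-support
    -- family, and the base is at most one.
    refine ENNReal.ofReal_le_ofReal (pow_le_pow_of_le_one (by positivity) ?_ ?_)
    · exact inv_le_one_of_one_le₀ (Real.one_le_sqrt.2 (by linarith))
    · have h1 := finrank_range_le_card (R := ℝ) fun j : ↥Iᶜ => x j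
      have h2 := Submodule.finrank_add_finrank_orthogonal
        (Submodule.span ℝ (Set.range fun j : ↥Iᶜ => x j))
      rw [Set.finrank, Fintype.card_coe, Finset.card_compl] at h1
      have h3 := Finset.card_le_univ I
      omega
  calc _ ≤ ∫⁻ _ : ι → E, ENNReal.ofReal ((√(1 + t))⁻¹ ^ d) ∂ν := lintegral_mono hbound
    _ = _ := by simp

theorem measurableSet_residualInner_nonpos (I : Finset ι) (i : ι) (s : ι → ℝ) :
    MeasurableSet {x : ι → E |
      residualInner (fun j : ↥Iᶜ => x j) (s i • x i) (∑ j ∈ I, s j • x j) ≤ 0} := by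
  have h1 : Measurable fun x : ι → E =>
      (((fun j : ↥Iᶜ => x j), s i • x i), ∑ j ∈ I, s j • x j) := by fun_prop
  have h2 := measurable_residualInner.comp h1
  exact h2 measurableSet_Iic

/-- Markov's inequality in exponential form: on the event the integrand of the previous bound is at
least one. -/
theorem measure_residualInner_nonpos_le {I : Finset ι} {i : ι} (hi : i ∈ I) {s : ι → ℝ}
    (hs : ∀ j ∈ I, s j * s j = 1) (hI : 2 ≤ I.card) {d : ℕ}
    (hd : d + Fintype.card ι ≤ Module.finrank ℝ E + I.card) :
    (Measure.pi fun _ : ι => stdGaussian E) {x |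
      residualInner (fun j : ↥Iᶜ => x j) (s i • x i) (∑ j ∈ I, s j • x j) ≤ 0}
      ≤ ENNReal.ofReal ((√(1 + ((I.card : ℝ) - 1)⁻¹))⁻¹ ^ d) := by
  refine le_trans ?_ (lintegral_exp_neg_residualInner_le hi hs hI hd)
  rw [← lintegral_indicator_one (measurableSet_residualInner_nonpos I i s)]
  refine lintegral_mono (Set.indicator_le fun x hx => ?_)
  rw [Pi.one_apply, ← ENNReal.ofReal_one]
  refine ENNReal.ofReal_le_ofReal (Real.one_le_exp ?_)
  have hk : (0 : ℝ) ≤ ((I.card : ℝ) - 1)⁻¹ := by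
    have : (2 : ℝ) ≤ I.card := by exact_mod_cast hI
    exact inv_nonneg.2 (by linarith)
  exact mul_nonneg_of_nonpos_of_nonpos (neg_nonpos.2 hk) hx

end GaussianFamily

/-! ### From independent entries to independent Gaussian columns. -/

theorem map_pi_pi_uncurry_swap {κ ι α : Type*} [Fintype κ] [Fintype ι] [MeasurableSpace α]
    (μ : Measure α) [IsProbabilityMeasure μ] :
    (Measure.pi fun _ : ι => Measure.pi fun _ : κ => μ).map
      (fun (y : ι → κ → α) (p : κ × ι) => y p.2 p.1) = Measure.pi fun _ : κ × ι => μ := by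
  refine (Measure.pi_eq fun s hs => ?_).symm
  rw [Measure.map_apply (by fun_prop) (MeasurableSet.univ_pi hs)]
  have : (fun (y : ι → κ → α) (p : κ × ι) => y p.2 p.1) ⁻¹' Set.univ.pi s
      = Set.univ.pi fun j => Set.univ.pi fun i => s (i, j) := by
    ext y
    simp only [Set.mem_preimage, Set.mem_univ_pi, Prod.forall]
    exact forall_comm
  rw [this, Measure.pi_pi]
  simp_rw [Measure.pi_pi]
  rw [Fintype.prod_prod_type_right]

namespace IsStandardGaussianEnsemble

variable {Ω : Type*} [MeasurableSpace Ω] {Q N : ℕ} {Φ : Ω → Matrix (Fin Q) (Fin N) ℝ}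
  {P : Measure Ω} [IsProbabilityMeasure P]

theorem aemeasurable_columns (hΦ : IsStandardGaussianEnsemble Φ P) :
    AEMeasurable (fun ω j => WithLp.toLp 2 fun i => Φ ω i j :
      Ω → Fin N → EuclideanSpace ℝ (Fin Q)) P := by
  refine aemeasurable_pi_lambda _ fun j => ?_
  exact (WithLp.measurable_toLp 2 (Fin Q → ℝ)).comp_aemeasurable
    (aemeasurable_pi_lambda _ fun i => (hΦ.hasLaw i j).aemeasurable)

theorem map_columns (hΦ : IsStandardGaussianEnsemble Φ P) :
    P.map (fun ω j => WithLp.toLp 2 fun i => Φ ω i j :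
      Ω → Fin N → EuclideanSpace ℝ (Fin Q))
      = Measure.pi fun _ : Fin N => stdGaussian (EuclideanSpace ℝ (Fin Q)) := by
  have hm : ∀ p : Fin Q × Fin N, AEMeasurable (fun ω => Φ ω p.1 p.2) P :=
    fun p => (hΦ.hasLaw p.1 p.2).aemeasurable
  have h1 := (iIndepFun_iff_map_fun_eq_pi_map hm).1 hΦ.indep
  simp_rw [fun p : Fin Q × Fin N => (hΦ.hasLaw p.1 p.2).map_eq] at h1
  rw [← map_pi_pi_uncurry_swap] at h1
  have hT : Measurable (fun (v : Fin Q × Fin N → ℝ) (j : Fin N) =>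
      (WithLp.toLp 2 fun i => v (i, j) : EuclideanSpace ℝ (Fin Q))) := by fun_prop
  have h2 := congrArg (fun m => m.map (fun (v : Fin Q × Fin N → ℝ) (j : Fin N) =>
      (WithLp.toLp 2 fun i => v (i, j) : EuclideanSpace ℝ (Fin Q)))) h1
  simp only at h2
  rw [AEMeasurable.map_map_of_aemeasurable hT.aemeasurable (aemeasurable_pi_lambda _ hm),
    Measure.map_map hT (by fun_prop)] at h2
  refine h2.trans ?_
  rw [← map_pi_eq_stdGaussian]
  exact Measure.pi_map_pi (f := fun _ => WithLp.toLp 2) fun _ => by fun_prop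

end IsStandardGaussianEnsemble

/-! ### Numerical estimates for the failure probability. -/

theorem exponent_nonneg (β k : ℝ) : 0 ≤ exponent β k := sq_nonneg _

/-- For `0 ≤ A ≤ B` one has `(B - A)² ≤ B² - A²`, and here the right side is `β - 1`. -/
theorem exponent_le {β k : ℝ} (hβ : 1 ≤ β) (hk : 0 < k) : exponent β k ≤ β - 1 := by
  have ha : 0 ≤ β / (2 * k) := by positivity
  have h1 : √(β / (2 * k)) ≤ √(β / (2 * k) + β - 1) := Real.sqrt_le_sqrt (by linarith)
  have h2 := Real.sq_sqrt ha
  have h3 := Real.sq_sqrt (show 0 ≤ β / (2 * k) + β - 1 by linarith)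
  rw [exponent]
  nlinarith [Real.sqrt_nonneg (β / (2 * k))]

theorem inv_sqrt_one_add_le_exp {k : ℝ} (hk : 1 < k) :
    (√(1 + (k - 1)⁻¹))⁻¹ ≤ Real.exp (-(1 / k) / 2) := by
  have hk1 : 0 < k - 1 := by linarith
  have h1 : (1 + (k - 1)⁻¹)⁻¹ = -(1 / k) + 1 := by
    have : k ≠ 0 := by linarith
    field_simp
    ring
  rw [← Real.sqrt_inv, h1, Real.exp_half]
  exact Real.sqrt_le_sqrt (Real.add_one_le_exp _)

theorem card_mul_inv_sqrt_pow_le {k β : ℝ} (hk : 2 ≤ k) (hβ : 1 ≤ β) {d : ℕ}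
    (hd : 2 * β * k * Real.log (k / 2) ≤ d) :
    k * (√(1 + (k - 1)⁻¹))⁻¹ ^ d ≤ 2 * (k / 2) ^ (-exponent β k) := by
  have hk0 : 0 < k := by linarith
  have h1 : (√(1 + (k - 1)⁻¹))⁻¹ ^ d ≤ Real.exp (-(β * Real.log (k / 2))) := by
    refine (pow_le_pow_left₀ (by positivity) (inv_sqrt_one_add_le_exp (by linarith)) d).trans ?_
    rw [← Real.exp_nat_mul, Real.exp_le_exp]
    have : β * Real.log (k / 2) ≤ d * (1 / k) / 2 := by
      rw [mul_one_div, div_div, le_div_iff₀ (by positivity)]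
      linarith
    linarith
  have h2 : Real.exp (-(β * Real.log (k / 2))) = (k / 2) ^ (-β) := by
    rw [Real.rpow_def_of_pos (by positivity)]
    ring_nf
  calc k * (√(1 + (k - 1)⁻¹))⁻¹ ^ d ≤ k * (k / 2) ^ (-β) := by
        rw [← h2]
        gcongr
    -- The factor `k` of the union bound costs one power of `k / 2` and the constant two.
    _ = 2 * (k / 2) ^ (1 - β) := by
        rw [sub_eq_add_neg, Real.rpow_add (by positivity), Real.rpow_one]
        ring
    _ ≤ 2 * (k / 2) ^ (-exponent β k) := by
        gcongr
        · linarith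
        · linarith [exponent_le hβ hk0]

/-! ### Assembly: union bound over the saturation support and the final theorem. -/

theorem linfIC_lt_one {N Q : ℕ} (hN : 0 < N) {x : EuclideanSpace ℝ (Fin N)} (hx : x ≠ 0)
    (Φ : Matrix (Fin Q) (Fin N) ℝ) {X : Fin N → EuclideanSpace ℝ (Fin Q)}
    (hX : X = fun j => WithLp.toLp 2 fun i => Φ i j)
    (hli : LinearIndependent ℝ fun j : ↥(saturationSupport x)ᶜ => X j)
    (hpos : ∀ i ∈ saturationSupport x,
      0 < residualInner (fun j : ↥(saturationSupport x)ᶜ => X j) (saturatedSign x i • X i)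
        (∑ j ∈ saturationSupport x, saturatedSign x j • X j)) :
    RestrictedInjective (Matrix.toEuclideanLin Φ) (modelSubspace linfNorm x) ∧
      linfIC Φ x < 1 := by
  have hcol : ∀ j, Matrix.toEuclideanLin Φ (EuclideanSpace.single j 1) = X j := by
    intro j
    rw [hX]
    ext i
    simp [Matrix.toLpLin_apply]
  simp only [residualInner, ← hcol] at hli hpos
  exact irrepresentability_linfNorm_lt_one hN hx _ hli hpos

theorem measure_failure_le {N Q : ℕ} (hN : 0 < N) {x : EuclideanSpace ℝ (Fin N)} (hx : x ≠ 0)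
    {Ω : Type*} [MeasurableSpace Ω] {P : Measure Ω} [IsProbabilityMeasure P]
    {Φ : Ω → Matrix (Fin Q) (Fin N) ℝ} (hΦ : IsStandardGaussianEnsemble Φ P)
    (hk : 2 ≤ (saturationSupport x).card) {d : ℕ} (hd : d + N ≤ Q + (saturationSupport x).card) :
    P {ω | RestrictedInjective (Matrix.toEuclideanLin (Φ ω)) (modelSubspace linfNorm x) ∧
        linfIC (Φ ω) x < 1}ᶜ
      ≤ ENNReal.ofReal ((saturationSupport x).card *
          (√(1 + (((saturationSupport x).card : ℝ) - 1)⁻¹))⁻¹ ^ d) := by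
  set I := saturationSupport x with hI
  set ν := Measure.pi fun _ : Fin N => stdGaussian (EuclideanSpace ℝ (Fin Q)) with hν
  set Ψ : Ω → Fin N → EuclideanSpace ℝ (Fin Q) := fun ω j => WithLp.toLp 2 fun i => Φ ω i j
    with hΨ
  have hsub : {ω | RestrictedInjective (Matrix.toEuclideanLin (Φ ω)) (modelSubspace linfNorm x) ∧
        linfIC (Φ ω) x < 1}ᶜ ⊆
      Ψ ⁻¹' ({X | ¬ LinearIndependent ℝ fun j : ↥Iᶜ => X j} ∪
        ⋃ i ∈ I, {X | residualInner (fun j : ↥Iᶜ => X j) (saturatedSign x i • X i)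
          (∑ j ∈ I, saturatedSign x j • X j) ≤ 0}) := by
    intro ω hω
    by_contra hgood
    simp only [Set.mem_preimage, Set.mem_union, Set.mem_ofPred_eq, Set.mem_iUnion, exists_prop,
      not_or, not_not, not_exists, not_and, not_le] at hgood
    exact hω (linfIC_lt_one hN hx (Φ ω) rfl hgood.1 hgood.2)
  have hnull : ν {X | ¬ LinearIndependent ℝ fun j : ↥Iᶜ => X j} = 0 := by
    refine ae_iff.1 (ae_linearIndependent_pi_stdGaussian Iᶜ ?_)
    rw [Finset.card_compl, Fintype.card_fin, finrank_euclideanSpace, Fintype.card_fin]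
    omega
  calc _ ≤ P (Ψ ⁻¹' _) := measure_mono hsub
    _ ≤ ν _ := by
        rw [hν, ← hΦ.map_columns]
        -- This inequality holds for arbitrary sets, so no measurability of the bad event is needed.
        exact Measure.le_map_apply hΦ.aemeasurable_columns _
    _ ≤ 0 + ∑ i ∈ I, ENNReal.ofReal ((√(1 + ((I.card : ℝ) - 1)⁻¹))⁻¹ ^ d) := by
        refine (measure_union_le _ _).trans (add_le_add hnull.le ?_)
        refine (measure_biUnion_finset_le _ _).trans (Finset.sum_le_sum fun i hi => ?_)
        refine measure_residualInner_nonpos_le hi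
          (fun j hj => saturatedSign_mul_self hx hj) hk ?_
        rwa [Fintype.card_fin, finrank_euclideanSpace, Fintype.card_fin]
    _ = _ := by
        rw [zero_add, Finset.sum_const, nsmul_eq_mul, ENNReal.ofReal_mul (Nat.cast_nonneg _),
          ENNReal.ofReal_natCast]

end

end PartlySmooth

theorem theorem7p1 {N Q : ℕ} (hN : 0 < N) (x : EuclideanSpace ℝ (Fin N)) (β : ℝ) (hβ : 1 < β)
    {Ω : Type*} [MeasurableSpace Ω] (P : Measure Ω) [IsProbabilityMeasure P]
    (Φ : Ω → Matrix (Fin Q) (Fin N) ℝ)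
    (hΦ : PartlySmooth.IsStandardGaussianEnsemble Φ P)
    (hQ : (N : ℝ) - ((PartlySmooth.saturationSupport x).card : ℝ)
        + 2 * β * ((PartlySmooth.saturationSupport x).card : ℝ)
          * Real.log (((PartlySmooth.saturationSupport x).card : ℝ) / 2) ≤ (Q : ℝ)) :
    1 - 2 * (((PartlySmooth.saturationSupport x).card : ℝ) / 2)
          ^ (-PartlySmooth.exponent β ((PartlySmooth.saturationSupport x).card : ℝ))
      ≤ P.real {ω |
          PartlySmooth.RestrictedInjective (Matrix.toEuclideanLin (Φ ω))
            (PartlySmooth.modelSubspace PartlySmooth.linfNorm x) ∧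
          PartlySmooth.linfIC (Φ ω) x < 1} := by
  have hcard : 0 < (PartlySmooth.saturationSupport x).card :=
    (PartlySmooth.saturationSupport_nonempty hN x).card_pos
  set k := (PartlySmooth.saturationSupport x).card with hk
  have hk0 : (0 : ℝ) < k := Nat.cast_pos.2 hcard
  by_cases hx : x = 0
  · have huniv : {ω | PartlySmooth.RestrictedInjective (Matrix.toEuclideanLin (Φ ω))
            (PartlySmooth.modelSubspace PartlySmooth.linfNorm x) ∧
          PartlySmooth.linfIC (Φ ω) x < 1} = Set.univ :=
      Set.eq_univ_of_forall fun ω => by rw [hx]; exact PartlySmooth.linfIC_zero (Φ ω)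
    rw [huniv, probReal_univ]
    have : 0 ≤ ((k : ℝ) / 2) ^ (-PartlySmooth.exponent β k) := by positivity
    linarith
  -- For `k ≤ 2` the base `k / 2` is at most one and the exponent nonpositive, so the claimed lower
  -- bound is negative.
  rcases le_or_gt k 2 with hk2 | hk2
  · have h1 : 1 ≤ ((k : ℝ) / 2) ^ (-PartlySmooth.exponent β k) := by
      refine Real.one_le_rpow_of_pos_of_le_one_of_nonpos (by positivity) ?_
        (neg_nonpos.2 (PartlySmooth.exponent_nonneg _ _))
      have : (k : ℝ) ≤ 2 := by exact_mod_cast hk2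
      linarith
    have h2 : 0 ≤ P.real {ω | PartlySmooth.RestrictedInjective (Matrix.toEuclideanLin (Φ ω))
            (PartlySmooth.modelSubspace PartlySmooth.linfNorm x) ∧
          PartlySmooth.linfIC (Φ ω) x < 1} := measureReal_nonneg
    linarith
  have hk2' : (2 : ℝ) ≤ k := by exact_mod_cast hk2.le
  have hlog : 0 ≤ 2 * β * (k : ℝ) * Real.log ((k : ℝ) / 2) :=
    mul_nonneg (by positivity) (Real.log_nonneg (by linarith))
  -- Ensures that the natural subtraction in `d = Q + k - N` is not truncated.
  have hNQ : N ≤ Q + k := by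
    have : (N : ℝ) ≤ Q + k := by linarith
    exact_mod_cast this
  have hfail := PartlySmooth.measure_failure_le hN hx hΦ hk2.le (d := Q + k - N) (by omega)
  have hnum := PartlySmooth.card_mul_inv_sqrt_pow_le hk2' hβ.le (d := Q + k - N)
    (by rw [Nat.cast_sub hNQ, Nat.cast_add]; linarith)
  set A := {ω | PartlySmooth.RestrictedInjective (Matrix.toEuclideanLin (Φ ω))
            (PartlySmooth.modelSubspace PartlySmooth.linfNorm x) ∧
          PartlySmooth.linfIC (Φ ω) x < 1} with hA
  have hcompl : P.real Aᶜ ≤ 2 * ((k : ℝ) / 2) ^ (-PartlySmooth.exponent β k) :=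
    (ENNReal.toReal_le_of_le_ofReal (by positivity) hfail).trans hnum
  -- Subadditivity replaces the complement formula, since `A` is not known to be measurable.
  have hunion := measureReal_union_le (μ := P) A Aᶜ
  rw [Set.union_compl_self, probReal_univ] at hunion
  linarith
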